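/- Let $n\ge 0$ and let $P\subset\mathbb R^n$ be a simple polytope, i.e. the convex hull of finitely many points, with nonempty interior, such that every vertex of $P$ lies in exactly $n$ facets (faces of dimension $n-1$) of $P$. Let $\{X_i\}_{i\in I}$ be a finite family of closed subsets of $\mathbb R^n$ with $P\subseteq\bigcup_{i\in I} X_i$ and with covering multiplicity at most $n$, i.e. no point of $P$ belongs to more than $n$ of the sets $X_i$. Then there is an $i\in I$ such that $X_i$ touches (has nonempty intersection with) at least $n+1$ facets of $P$. -/

import Mathlib

/-- A facet of a convex set `P` in `ℝⁿ`: a nonempty intersection of `P` with a supporting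
hyperplane, of affine dimension `n - 1`. -/
structure IsFacet {n : ℕ} (P F : Set (EuclideanSpace ℝ (Fin n))) : Prop where
  exposed : IsExposed ℝ P F
  nonempty : F.Nonempty
  finrank_add_one : Module.finrank ℝ (vectorSpan ℝ F) + 1 = n

/-- A simple (convex, full-dimensional) polytope in `ℝⁿ`: the convex hull of finitely many points,
with nonempty interior, each of whose vertices lies in exactly `n` facets. -/
structure IsSimplePolytope {n : ℕ} (P : Set (EuclideanSpace ℝ (Fin n))) : Prop where
  exists_convexHull : ∃ s : Finset (EuclideanSpace ℝ (Fin n)), P = convexHull ℝ (s : Set _)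
  interior_nonempty : (interior P).Nonempty
  encard_facets : ∀ v ∈ P.extremePoints ℝ, {F | IsFacet P F ∧ v ∈ F}.encard = n

open Set Metric MeasureTheory Topology

/-! Suppose every `X i` touches at most `n` facets. Each facet `F` lies in a hyperplane `⟪w F, y⟫ =
c F`. Perturb the normals slightly to `w'`, so that any `n` of the equations `⟪w' F, a⟫ = c F` are
jointly solvable (`exists_perturbation_solvable`), and let `a i` solve those for the facets touched
by `X i`. Averaging the `a i` with weights supported near the `X i` gives a continuous map `g` on
`P` that sends each facet `F` into the perturbed hyperplane of `F`. For a suitable interior point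
`p`, that hyperplane still has `p` strictly on one side and `F` on the far side of the parallel
hyperplane through `p`. So `g x` never lies on the ray from `p` opposite to a boundary point `x`,
and Brouwer's theorem, in the form `exists_eq_of_forall_frontier`, makes `p` a value of `g`. But
every value of `g` is a convex combination of at most `n` of the `a i`, by the multiplicity bound,
and a generic `p` avoids all such hulls. Brouwer's theorem is proved by volume: `∫ det (1 + t Du)`
is polynomial in `t` and constant for small `t`. -/

/-! ### Small perturbations of the identity -/

theorem Matrix.eval_det_X_smul_map_C_add {ι R : Type*} [Fintype ι] [DecidableEq ι] [CommRing R]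
    (A B : Matrix ι ι R) (t : R) :
    (Matrix.det ((Polynomial.X : Polynomial R) • A.map Polynomial.C + B.map Polynomial.C)).eval t =
      (t • A + B).det := by
  rw [← Polynomial.coe_evalRingHom, RingHom.map_det]
  congr 1
  ext i j
  simp
  ring

/-- For a fixed endomorphism `A`, the function `t ↦ det (1 + t A)` is a polynomial of degree at most
the dimension. -/
theorem ContinuousLinearMap.exists_polynomial_eval_eq_det_one_add_smul {E : Type*}
    [NormedAddCommGroup E] [NormedSpace ℝ E] [FiniteDimensional ℝ E] (A : E →L[ℝ] E) :
    ∃ p : Polynomial ℝ, p.natDegree ≤ Module.finrank ℝ E ∧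
      ∀ t : ℝ, p.eval t = (1 + t • A).det := by
  classical
  let b := Module.finBasis ℝ E
  let M := LinearMap.toMatrix b b (A : E →ₗ[ℝ] E)
  refine ⟨_, (Polynomial.natDegree_det_X_add_C_le M 1).trans (by simp), fun t ↦ ?_⟩
  rw [Matrix.eval_det_X_smul_map_C_add, ContinuousLinearMap.det, ← LinearMap.det_toMatrix b]
  congr 1
  ext i j
  simp [M, LinearMap.toMatrix_apply, Matrix.one_apply, Finsupp.single_apply, add_comm, eq_comm]

/-- A kernel vector `v` of `1 + s A` with `s ≤ t` would satisfy `‖v‖ = s ‖A v‖ ≤ t C ‖v‖ < ‖v‖`. So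
the determinant does not vanish on `[0, t]` and keeps the sign of its value `1` at `s = 0`. -/
theorem det_one_add_smul_pos {E : Type*} [NormedAddCommGroup E] [NormedSpace ℝ E]
    [FiniteDimensional ℝ E] (A : E →L[ℝ] E) {t C : ℝ} (ht : 0 ≤ t) (hA : ‖A‖ ≤ C)
    (htC : t * C < 1) : 0 < (1 + t • A).det := by
  have hne : ∀ s ∈ Icc 0 t, (1 + s • A).det ≠ 0 := by
    intro s hs h0
    obtain ⟨v, hv, hv0⟩ := (Submodule.ne_bot_iff _).1 (LinearMap.bot_lt_ker_of_det_eq_zero h0).ne'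
    have hv' : v + s • A v = 0 := by simpa using hv
    have h1 : ‖v‖ = s * ‖A v‖ := by
      rw [← norm_neg, ← eq_neg_of_add_eq_zero_right hv', norm_smul, Real.norm_of_nonneg hs.1]
    have h2 : s * ‖A v‖ ≤ t * (C * ‖v‖) := by
      gcongr
      · exact hs.2
      · exact A.le_of_opNorm_le hA v
    nlinarith [norm_pos_iff.2 hv0]
  by_contra! hneg
  have hcont : ContinuousOn (fun s : ℝ ↦ (1 + s • A).det) (Icc 0 t) :=
    (ContinuousLinearMap.continuous_det.comp (by fun_prop)).continuousOn
  obtain ⟨s, hs, hs0⟩ := intermediate_value_Icc' ht hcont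
    (show (0 : ℝ) ∈ Icc _ _ from ⟨hneg, by simp [ContinuousLinearMap.det]⟩)
  exact hne s hs hs0

/-- Lipschitz continuity of the extension by zero of a Lipschitz map on a ball that vanishes on the
boundary sphere. -/
theorem lipschitzWith_indicator_ball {E F : Type*} [NormedAddCommGroup E] [NormedSpace ℝ E]
    [NormedAddCommGroup F] {u : E → F} {R : ℝ} {C : NNReal}
    (hu : LipschitzOnWith C u (closedBall 0 R)) (h0 : ∀ x, ‖x‖ = R → u x = 0) :
    LipschitzWith C ((ball (0 : E) R).indicator u) := by
  have key : ∀ x ∈ ball (0 : E) R, ∀ y ∉ ball (0 : E) R, ‖u x‖ ≤ C * ‖x - y‖ := by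
    intro x hx y hy
    rw [mem_ball_zero_iff] at hx
    rw [mem_ball_zero_iff, not_lt] at hy
    -- `z` is a point where the segment from `x` to `y` crosses the sphere.
    obtain ⟨z, hz, hxz⟩ : ∃ z : E, ‖z‖ = R ∧ ‖x - z‖ ≤ ‖x - y‖ := by
      obtain ⟨s, hs, hs'⟩ := intermediate_value_Icc (zero_le_one' ℝ)
        (f := fun s : ℝ ↦ ‖x + s • (y - x)‖) (by fun_prop)
        (show R ∈ Icc _ _ by simpa using ⟨hx.le, hy⟩)
      refine ⟨_, hs', ?_⟩
      rw [sub_add_cancel_left, norm_neg, norm_smul, Real.norm_of_nonneg hs.1, norm_sub_rev y x]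
      exact mul_le_of_le_one_left (norm_nonneg _) hs.2
    have := hu.norm_sub_le (x := x) (y := z) (by simpa using hx.le) (by simp [hz])
    rw [h0 z hz, sub_zero] at this
    exact this.trans (by gcongr)
  refine LipschitzWith.of_dist_le_mul fun x y ↦ ?_
  rw [dist_eq_norm, dist_eq_norm]
  by_cases hx : x ∈ ball (0 : E) R <;> by_cases hy : y ∈ ball (0 : E) R
  · rw [indicator_of_mem hx, indicator_of_mem hy]
    exact hu.norm_sub_le (ball_subset_closedBall hx) (ball_subset_closedBall hy)
  · simpa [indicator_of_mem hx, indicator_of_notMem hy] using key x hx y hy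
  · simpa [indicator_of_notMem hx, indicator_of_mem hy, norm_sub_rev x y] using key y hy x hx
  · simpa [indicator_of_notMem hx, indicator_of_notMem hy] using by positivity

theorem bijective_add_of_lipschitzWith {E : Type*} [NormedAddCommGroup E] [NormedSpace ℝ E]
    [CompleteSpace E] {v : E → E} {c : NNReal} (hv : LipschitzWith c v) (hc : c < 1) :
    Function.Bijective fun x ↦ x + v x := by
  have hf : ApproximatesLinearOn (fun x ↦ x + v x)
      ((ContinuousLinearEquiv.refl ℝ E : E ≃L[ℝ] E) : E →L[ℝ] E) univ c := by
    intro x _ y _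
    simpa [add_sub_add_comm] using hv.norm_sub_le x y
  have hc' : Subsingleton E ∨
      c < ‖((ContinuousLinearEquiv.refl ℝ E).symm : E →L[ℝ] E)‖₊⁻¹ := by
    rcases subsingleton_or_nontrivial E with h | h
    · exact Or.inl h
    · right
      have h1 : ‖((ContinuousLinearEquiv.refl ℝ E).symm : E →L[ℝ] E)‖₊ = 1 :=
        NNReal.eq ContinuousLinearMap.norm_id
      rwa [h1, inv_one]
  exact ⟨injOn_univ.1 (hf.injOn hc'), hf.surjective hc'⟩

/-! ### Brouwer's fixed point theorem -/

section Brouwer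

variable {E : Type*} [NormedAddCommGroup E] [InnerProductSpace ℝ E] [FiniteDimensional ℝ E]

/-- A `C¹` perturbation of the identity that fixes the boundary sphere preserves the signed volume
of a ball. -/
theorem setIntegral_det_one_add_fderiv_ball [MeasurableSpace E] [BorelSpace E] {u : E → E}
    (hu : ContDiff ℝ 1 u) {R : ℝ} (h0 : ∀ x, ‖x‖ = R → u x = 0) :
    ∫ x in ball (0 : E) R, (1 + fderiv ℝ u x).det = volume.real (ball (0 : E) R) := by
  classical
  have hdiff : Differentiable ℝ u := hu.differentiable one_ne_zero
  have hcf : Continuous (fderiv ℝ u) := hu.continuous_fderiv one_ne_zero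
  obtain ⟨C, hC⟩ : ∃ C : NNReal, ∀ x ∈ closedBall (0 : E) R, ‖fderiv ℝ u x‖₊ ≤ C := by
    obtain ⟨C, hC⟩ := (isCompact_closedBall (0 : E) R).exists_bound_of_continuousOn
      hcf.continuousOn
    exact ⟨C.toNNReal, fun x hx ↦ NNReal.le_toNNReal_of_coe_le (hC x hx)⟩
  have hLip := lipschitzWith_indicator_ball
    ((convex_closedBall (0 : E) R).lipschitzOnWith_of_nnnorm_fderiv_le
      (fun x _ ↦ hdiff x) hC) h0
  have hsmall : ∀ t : ℝ, 0 ≤ t → t * C < 1 →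
      ∫ x in ball (0 : E) R, (1 + t • fderiv ℝ u x).det = volume.real (ball (0 : E) R) := by
    intro t ht htC
    lift t to NNReal using ht
    -- Extended by zero, `u` stays `C`-Lipschitz, so `x + t v x` is a bijection of `E`. It fixes
    -- every point outside the ball, hence maps the ball onto itself.
    set v := (ball (0 : E) R).indicator u with hv
    have hbij := bijective_add_of_lipschitzWith (v := fun x ↦ t • v x) (c := t * C)
      (by
        refine LipschitzWith.of_dist_le_mul fun x y ↦ ?_
        have := hLip.dist_le_mul x y
        rw [NNReal.smul_def, NNReal.smul_def, dist_smul₀, NNReal.coe_mul, mul_assoc,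
          NNReal.norm_eq]
        gcongr)
      (by exact_mod_cast htC)
    have hin : ∀ x ∈ ball (0 : E) R, x + t • v x = x + t • u x := fun x hx ↦ by
      rw [hv, indicator_of_mem hx]
    have hout : ∀ x ∉ ball (0 : E) R, x + t • v x = x := fun x hx ↦ by
      rw [hv, indicator_of_notMem hx, smul_zero, add_zero]
    have himage : (fun x ↦ x + t • u x) '' ball (0 : E) R = ball (0 : E) R := by
      ext y
      constructor
      · rintro ⟨x, hx, rfl⟩
        by_contra hy
        have h1 := hout _ hy
        simp only at h1
        rw [← hin x hx] at h1
        have h2 : x + t • v x = x := hbij.1 h1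
        rw [hin x hx] at h2
        exact hy (by simpa only [h2] using hx)
      · intro hy
        obtain ⟨x, hx⟩ := hbij.2 y
        have hxB : x ∈ ball (0 : E) R := by
          by_contra hxB
          have h1 := hout x hxB
          simp only at hx
          rw [h1] at hx
          exact hxB (hx ▸ hy)
        exact ⟨x, hxB, by rw [← hx]; exact (hin x hxB).symm⟩
    have hinj : InjOn (fun x ↦ x + t • u x) (ball (0 : E) R) := by
      intro x hx y hy hxy
      simp only at hxy
      rw [← hin x hx, ← hin y hy] at hxy
      exact hbij.1 hxy
    have hchange := integral_image_eq_integral_abs_det_fderiv_smul (volume : Measure E)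
      (s := ball (0 : E) R) (f := fun x ↦ x + t • u x)
      (f' := fun x ↦ 1 + (t : ℝ) • fderiv ℝ u x) measurableSet_ball
      (fun x _ ↦ ((hasFDerivAt_id x).add
        ((hdiff x).hasFDerivAt.const_smul (t : ℝ))).hasFDerivWithinAt) hinj (fun _ ↦ (1 : ℝ))
    rw [himage] at hchange
    simp only [smul_eq_mul, mul_one, integral_const, measureReal_restrict_apply_univ] at hchange
    rw [hchange]
    refine setIntegral_congr_fun measurableSet_ball fun x hx ↦ ?_
    exact (abs_of_pos (det_one_add_smul_pos _ t.2
      (by exact_mod_cast hC x (ball_subset_closedBall hx)) htC)).symm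
  set N := Module.finrank ℝ E
  -- `N + 1` distinct nodes, all in the small range `τ C < 1`, determine a polynomial of degree at
  -- most `N`. Its value at `1` is thus a fixed combination, with weights `lam` of sum `1`, of
  -- values already integrated.
  let τ : ℕ → ℝ := fun k ↦ k / ((N + 1) * (C + 1))
  have hτ0 : ∀ k, 0 ≤ τ k := fun k ↦ by positivity
  have hτ : ∀ k ∈ Finset.range (N + 1), τ k * C < 1 := by
    intro k hk
    have hk' : (k : ℝ) < N + 1 := by exact_mod_cast Finset.mem_range.1 hk
    have hC0 := C.2
    rw [div_mul_eq_mul_div, div_lt_one (by positivity)]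
    calc (k : ℝ) * C ≤ (N + 1) * C := by gcongr
      _ < (N + 1) * (C + 1) := by gcongr; linarith
  have hinj : InjOn τ (Finset.range (N + 1)) := by
    intro a _ b _ hab
    have hne : ((N : ℝ) + 1) * (C + 1) ≠ 0 := by positivity
    exact_mod_cast (div_left_inj' hne).1 hab
  let lam : ℕ → ℝ := fun k ↦ (Lagrange.basis (Finset.range (N + 1)) τ k).eval 1
  have hlam : ∑ k ∈ Finset.range (N + 1), lam k = 1 := by
    simp only [lam]
    rw [← Polynomial.eval_finsetSum, Lagrange.sum_basis hinj (by simp), Polynomial.eval_one]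
  have hlagr : ∀ x, (1 + fderiv ℝ u x).det =
      ∑ k ∈ Finset.range (N + 1), (1 + τ k • fderiv ℝ u x).det * lam k := by
    intro x
    obtain ⟨p, hp, hpe⟩ := (fderiv ℝ u x).exists_polynomial_eval_eq_det_one_add_smul
    have hdeg : p.degree < (Finset.range (N + 1)).card := by
      rw [Finset.card_range]
      exact lt_of_le_of_lt (Polynomial.degree_le_of_natDegree_le hp)
        (by exact_mod_cast Nat.lt_succ_self N)
    have h1 := congrArg (Polynomial.eval 1) (Lagrange.eq_interpolate hinj hdeg)
    rw [hpe, one_smul, Lagrange.interpolate_apply, Polynomial.eval_finsetSum] at h1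
    rw [h1]
    simp [hpe, lam]
  have hintr : ∀ t : ℝ, IntegrableOn (fun x ↦ (1 + t • fderiv ℝ u x).det) (ball (0 : E) R) :=
    fun t ↦ ((ContinuousLinearMap.continuous_det.comp
      (continuous_const.add (hcf.const_smul t))).continuousOn.integrableOn_compact
        (isCompact_closedBall 0 R)).mono_set ball_subset_closedBall
  simp_rw [hlagr]
  rw [integral_finsetSum _ fun k _ ↦ (hintr (τ k)).mul_const _]
  simp_rw [integral_mul_const]
  rw [Finset.sum_congr rfl fun k hk ↦ by rw [hsmall (τ k) (hτ0 k) (hτ k hk)], ← Finset.mul_sum,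
    hlam, mul_one]

/-- A `C¹` map that is the identity on a sphere around the origin has a zero. -/
theorem exists_eq_zero_of_contDiff {g : E → E} (hg : ContDiff ℝ 1 g) {R : ℝ} (hR : 0 < R)
    (hgR : ∀ x, ‖x‖ = R → g x = x) : ∃ x, g x = 0 := by
  by_contra! hne
  borelize E
  -- The radial projection of `g` to the sphere of radius `R` would be a `C¹` retraction of the
  -- ball.
  let f : E → E := fun x ↦ (R * ‖g x‖⁻¹) • g x
  have hf : ContDiff ℝ 1 f :=
    (contDiff_const.mul ((hg.norm ℝ hne).inv fun x ↦ norm_ne_zero_iff.2 (hne x))).smul hg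
  have hnorm : ∀ x, ‖f x‖ = R := fun x ↦ by
    rw [norm_smul, norm_mul, norm_inv, norm_norm, Real.norm_of_nonneg hR.le, mul_assoc,
      inv_mul_cancel₀ (norm_ne_zero_iff.2 (hne x)), mul_one]
  have hvol := setIntegral_det_one_add_fderiv_ball (R := R) (u := fun x ↦ f x - x)
    (hf.sub contDiff_id)
    fun x hx ↦ by simp [f, hgR x hx, hx, hR.ne']
  have hdet : ∀ x, (1 + fderiv ℝ (fun x ↦ f x - x) x).det = 0 := by
    intro x
    have hdf : DifferentiableAt ℝ f x := hf.differentiable one_ne_zero x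
    have h1 : 1 + fderiv ℝ (fun x ↦ f x - x) x = fderiv ℝ f x := by
      rw [fderiv_fun_sub hdf differentiableAt_fun_id, fderiv_fun_id]
      exact add_sub_cancel _ _
    rw [h1]
    -- Since `‖f‖` is constant, `f x ≠ 0` is orthogonal to the range of the derivative, which is
    -- therefore not surjective.
    have horth : ∀ v, inner ℝ (f x) (fderiv ℝ f x v) = 0 := by
      intro v
      have h2 := (hdf.hasFDerivAt.inner ℝ hdf.hasFDerivAt)
      have h3 : (fun y ↦ inner ℝ (f y) (f y)) = fun _ : E ↦ R ^ 2 := by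
        funext y; rw [real_inner_self_eq_norm_sq, hnorm]
      rw [h3] at h2
      have h4 := congrArg (fun L ↦ L v) (h2.unique (hasFDerivAt_const (R ^ 2) x))
      simp [real_inner_comm] at h4
      linarith
    by_contra hd
    have hu : IsUnit (LinearMap.det (fderiv ℝ f x : E →ₗ[ℝ] E)) := isUnit_iff_ne_zero.2 hd
    obtain ⟨v, hv⟩ := ((LinearMap.isUnit_iff_isUnit_det _).2 hu |>
      (Module.End.isUnit_iff _).1).2 (f x)
    have h5 := horth v
    rw [ContinuousLinearMap.coe_coe] at hv
    rw [hv, real_inner_self_eq_norm_sq, hnorm] at h5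
    exact hR.ne' (pow_eq_zero_iff two_ne_zero |>.1 h5)
  simp_rw [hdet] at hvol
  rw [integral_zero] at hvol
  exact (ENNReal.toReal_pos (measure_ball_pos volume (0 : E) hR).ne' measure_ball_lt_top.ne).ne hvol

/-- Smooth approximation reduces the continuous case to the `C¹` one. -/
theorem exists_add_eq_zero_of_hasCompactSupport {U : E → E} (hU : Continuous U)
    (hc : HasCompactSupport U) : ∃ x, x + U x = 0 := by
  by_contra! hne
  obtain ⟨R, hR, hUR⟩ : ∃ R : ℝ, 0 < R ∧ ∀ x, R ≤ ‖x‖ → U x = 0 := by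
    obtain ⟨R, hR⟩ := hc.isCompact.isBounded.subset_ball (0 : E)
    refine ⟨max R 1, by positivity, fun x hx ↦ image_eq_zero_of_notMem_tsupport fun h ↦ ?_⟩
    exact absurd (mem_ball_zero_iff.1 (hR h)) (not_lt.2 ((le_max_left _ _).trans hx))
  obtain ⟨x₀, -, hx₀⟩ := (isCompact_closedBall (0 : E) R).exists_isMinOn
    ⟨0, by simpa using hR.le⟩ (f := fun x ↦ ‖x + U x‖) (by fun_prop)
  -- The first bound excludes a zero of the smoothed map in the ball of radius `R`, the second one
  -- outside it, where `U = 0`. The cutoff `χ` makes that map the identity on the sphere of radius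
  -- `2 * R`.
  set δ := min ‖x₀ + U x₀‖ R with hδ
  have hδ0 : 0 < δ := lt_min (norm_pos_iff.2 (hne x₀)) hR
  obtain ⟨V, hV, hVU⟩ := (hc.uniformContinuous_of_continuous hU).exists_contDiff_dist_le hδ0
  let χ : ContDiffBump (0 : E) := ⟨R, 2 * R, hR, by linarith⟩
  obtain ⟨x, hx⟩ := exists_eq_zero_of_contDiff (g := fun x ↦ x + χ x • V x) (R := 2 * R)
    (contDiff_id.add (χ.contDiff.smul (hV.of_le (by simp)))) (by positivity) fun x hx ↦ by
      simp [χ.zero_of_le_dist (x := x) (by simp [χ, hx])]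
  have hVx := hVU x
  rw [dist_eq_norm] at hVx
  rcases le_total ‖x‖ R with h | h
  · rw [χ.one_of_mem_closedBall (by simpa [χ] using h), one_smul] at hx
    have h1 : ‖x₀ + U x₀‖ ≤ ‖x + U x‖ := hx₀ (by simpa using h)
    have h2 : V x - U x = -(x + U x) := by
      rw [eq_neg_of_add_eq_zero_right hx]; abel
    rw [h2, norm_neg] at hVx
    exact absurd (hVx.trans_le (min_le_left _ _)) (not_lt.2 h1)
  · rw [hUR x h, sub_zero] at hVx
    have h1 : ‖x‖ = χ x * ‖V x‖ := by
      rw [← norm_neg, ← eq_neg_of_add_eq_zero_right hx, norm_smul, Real.norm_of_nonneg χ.nonneg]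
    have h2 : χ x * ‖V x‖ ≤ ‖V x‖ := mul_le_of_le_one_left (norm_nonneg _) χ.le_one
    linarith [min_le_right ‖x₀ + U x₀‖ R]

/-- **Brouwer's fixed point theorem** for bounded maps of a Euclidean space to itself. -/
theorem exists_fixedPoint_of_continuous_of_bounded {h : E → E} (hh : Continuous h) {M : ℝ}
    (hM : ∀ x, ‖h x‖ ≤ M) : ∃ x, h x = x := by
  have hM0 : 0 ≤ M := (norm_nonneg _).trans (hM 0)
  -- A zero of `x - χ x • h x` has norm at most `M`, where `χ = 1`; so it is a fixed point of `h`.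
  let χ : ContDiffBump (0 : E) := ⟨M + 1, M + 2, by linarith, by linarith⟩
  obtain ⟨x, hx⟩ := exists_add_eq_zero_of_hasCompactSupport (U := fun x ↦ χ x • -h x)
    (χ.continuous.smul hh.neg) χ.hasCompactSupport.smul_right
  have hx' : x = χ x • h x := by
    rw [smul_neg] at hx
    simpa using eq_neg_of_add_eq_zero_left hx
  have hxM : ‖x‖ ≤ M := by
    rw [hx', norm_smul, Real.norm_of_nonneg χ.nonneg]
    exact (mul_le_of_le_one_left (norm_nonneg _) χ.le_one).trans (hM x)
  rw [χ.one_of_mem_closedBall (by simp [χ]; linarith), one_smul] at hx'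
  exact ⟨x, hx'.symm⟩

end Brouwer

/-! ### Zeros of maps on convex bodies -/

section Zeros

variable {E : Type*} [NormedAddCommGroup E] [InnerProductSpace ℝ E] [FiniteDimensional ℝ E]

/-- Without zeros, `-g` composed with the radial retraction `ρ` onto `K` can be rescaled to have
gauge `1`. A fixed point of the result is a frontier point `x` with `g x` a nonpositive multiple of
`x`. -/
theorem exists_eq_zero_of_forall_frontier {K : Set E} (hconv : Convex ℝ K) (hcomp : IsCompact K)
    (hK : K ∈ 𝓝 (0 : E)) {g : E → E} (hg : ContinuousOn g K)
    (hfr : ∀ x ∈ frontier K, ∀ r : ℝ, 0 ≤ r → g x ≠ -(r • x)) : ∃ x ∈ K, g x = 0 := by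
  by_contra! hne
  have habs : Absorbent ℝ K := absorbent_nhds_zero hK
  have hb : Bornology.IsVonNBounded ℝ K := (NormedSpace.isVonNBounded_iff ℝ).2 hcomp.isBounded
  have hcg : Continuous (gauge K) := continuous_gauge hconv hK
  have hmem : ∀ x, gauge K x ≤ 1 → x ∈ K := fun x hx ↦ by
    have := (gauge_le_one_iff_mem_closure hconv hK).1 hx
    rwa [hcomp.isClosed.closure_eq] at this
  let ρ : E → E := fun x ↦ (max 1 (gauge K x))⁻¹ • x
  have hmax : ∀ x, 0 < max 1 (gauge K x) := fun x ↦ lt_max_of_lt_left one_pos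
  have hρ : Continuous ρ :=
    ((continuous_const.max hcg).inv₀ fun x ↦ (hmax x).ne').smul continuous_id
  have hρK : ∀ x, ρ x ∈ K := fun x ↦ hmem _ <| by
    rw [gauge_smul_of_nonneg (inv_nonneg.2 (hmax x).le), smul_eq_mul, inv_mul_le_one₀ (hmax x)]
    exact le_max_right _ _
  have hG : Continuous fun x ↦ -g (ρ x) := (hg.comp_continuous hρ hρK).neg
  have hpos : ∀ x, 0 < gauge K (-g (ρ x)) := fun x ↦
    (gauge_pos habs hb).2 (neg_ne_zero.2 (hne _ (hρK x)))
  let h : E → E := fun x ↦ (gauge K (-g (ρ x)))⁻¹ • -g (ρ x)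
  have hh : Continuous h := ((hcg.comp hG).inv₀ fun x ↦ (hpos x).ne').smul hG
  have hgauge : ∀ x, gauge K (h x) = 1 := fun x ↦ by
    rw [gauge_smul_of_nonneg (inv_nonneg.2 (hpos x).le), smul_eq_mul, inv_mul_cancel₀ (hpos x).ne']
  obtain ⟨M, hM⟩ := hcomp.isBounded.exists_norm_le
  obtain ⟨x, hx⟩ := exists_fixedPoint_of_continuous_of_bounded hh
    fun x ↦ hM _ (hmem _ (hgauge x).le)
  have hx1 : gauge K x = 1 := by rw [← hgauge x, hx]
  have hρx : ρ x = x := by simp [ρ, hx1]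
  refine hfr x ((gauge_eq_one_iff_mem_frontier hconv hK).1 hx1) _ (hpos x).le ?_
  have h2 : gauge K (-g (ρ x)) • x = -g (ρ x) :=
    ((inv_smul_eq_iff₀ (hpos x).ne').1 hx).symm
  rw [h2, hρx, neg_neg]

/-- If a continuous map on a convex body never sends a boundary point `x` into the ray from the
interior point `p` opposite to `x`, then `p` is in its image. -/
theorem exists_eq_of_forall_frontier {K : Set E} (hconv : Convex ℝ K) (hcomp : IsCompact K) {p : E}
    (hp : p ∈ interior K) {g : E → E} (hg : ContinuousOn g K)
    (hfr : ∀ x ∈ frontier K, ∀ r : ℝ, 0 ≤ r → g x - p ≠ -(r • (x - p))) : ∃ x ∈ K, g x = p := by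
  let e := Homeomorph.addRight p
  obtain ⟨x, hx, hgx⟩ := exists_eq_zero_of_forall_frontier (K := e ⁻¹' K)
    (g := fun y ↦ g (e y) - p) (hconv.translate_preimage_left p) (e.isCompact_preimage.2 hcomp)
    (e.continuous.continuousAt.preimage_mem_nhds
      (by simpa [e] using mem_interior_iff_mem_nhds.1 hp))
    ((hg.comp e.continuous.continuousOn fun _ h ↦ h).sub continuousOn_const)
    (fun x hx r hr ↦ by
      rw [← e.preimage_frontier] at hx
      simpa [e] using hfr _ hx r hr)
  exact ⟨e x, hx, sub_eq_zero.1 hgx⟩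

end Zeros

/-! ### Supporting hyperplanes spanned by vertices -/

section Facets

variable {E : Type*} [NormedAddCommGroup E] [InnerProductSpace ℝ E] [FiniteDimensional ℝ E]

/-- A finite set of points on one side of a hyperplane through `x`, not spanning it together with
`x`: the hyperplane can be rotated so as to contain more of the points. -/
theorem exists_rotate_supporting {s : Finset E} {x w : E}
    (hspan : Submodule.span ℝ ((fun v ↦ v - x) '' (s : Set E)) = ⊤) (hw : w ≠ 0)
    (hle : ∀ v ∈ s, inner ℝ w (v - x) ≤ 0) {W : Submodule ℝ E}
    (hW : W = Submodule.span ℝ ((fun v ↦ v - x) '' {v | v ∈ s ∧ inner ℝ w (v - x) = 0}))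
    (hfin : Module.finrank ℝ W + 1 < Module.finrank ℝ E) :
    ∃ w' : E, w' ≠ 0 ∧ (∀ v ∈ s, inner ℝ w' (v - x) ≤ 0) ∧
      W < Submodule.span ℝ ((fun v ↦ v - x) '' {v | v ∈ s ∧ inner ℝ w' (v - x) = 0}) := by
  -- Tilting `w` along `u` keeps the points already on the hyperplane there; the rank bound leaves
  -- room for such a direction.
  obtain ⟨u, hu, hu0⟩ : ∃ u ∈ (W ⊔ Submodule.span ℝ {w})ᗮ, u ≠ 0 := by
    refine (Submodule.ne_bot_iff _).1 fun hbot ↦ ?_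
    rw [Submodule.orthogonal_eq_bot_iff] at hbot
    have h1 := Submodule.finrank_add_le_finrank_add_finrank W (Submodule.span ℝ {w})
    rw [hbot, finrank_top, finrank_span_singleton hw] at h1
    omega
  have huW : ∀ y ∈ W, inner ℝ u y = 0 := fun y hy ↦
    Submodule.inner_left_of_mem_orthogonal (Submodule.mem_sup_left hy) hu
  have huw : inner ℝ w u = 0 :=
    Submodule.inner_right_of_mem_orthogonal
      (Submodule.mem_sup_right (Submodule.mem_span_singleton_self w)) hu
  obtain ⟨u, huW, huw, hpos⟩ : ∃ u : E, (∀ y ∈ W, inner ℝ u y = 0) ∧ inner ℝ w u = 0 ∧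
      ∃ v ∈ s, 0 < inner ℝ u (v - x) := by
    obtain ⟨v, hv, hne⟩ : ∃ v ∈ s, inner ℝ u (v - x) ≠ 0 := by
      by_contra! h0
      refine hu0 ?_
      have h1 : Submodule.span ℝ ((fun v ↦ v - x) '' (s : Set E)) ≤ (Submodule.span ℝ {u})ᗮ := by
        rw [Submodule.span_le]
        rintro _ ⟨v, hv, rfl⟩
        exact Submodule.mem_orthogonal_singleton_iff_inner_right.2 (h0 v hv)
      rw [hspan] at h1
      exact inner_self_eq_zero.1
        (Submodule.mem_orthogonal_singleton_iff_inner_right.1 (h1 (Submodule.mem_top (x := u))))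
    rcases hne.lt_or_gt with h | h
    · exact ⟨-u, fun y hy ↦ by simp [huW y hy], by simp [huw], v, hv, by simpa using h⟩
    · exact ⟨u, huW, huw, v, hv, h⟩
  classical
  let T := s.filter fun v ↦ 0 < inner ℝ u (v - x)
  -- The minimal ratio is the first `t` at which `w + t • u` vanishes on some `v - x` with `⟪u, v -
  -- x⟫ > 0`; up to then no point crosses the hyperplane.
  obtain ⟨v₀, hv₀, hmin⟩ := T.exists_min_image
    (fun v ↦ -inner ℝ w (v - x) / inner ℝ u (v - x))
    (by obtain ⟨v, hv, h⟩ := hpos; exact ⟨v, Finset.mem_filter.2 ⟨hv, h⟩⟩)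
  obtain ⟨hv₀s, hv₀pos⟩ := Finset.mem_filter.1 hv₀
  set t := -inner ℝ w (v₀ - x) / inner ℝ u (v₀ - x) with ht
  have ht0 : 0 ≤ t := div_nonneg (neg_nonneg.2 (hle _ hv₀s)) hv₀pos.le
  have hinner : ∀ y, inner ℝ (w + t • u) y = inner ℝ w y + t * inner ℝ u y := fun y ↦ by
    rw [inner_add_left, real_inner_smul_left]
  have hv₀0 : inner ℝ (w + t • u) (v₀ - x) = 0 := by
    rw [hinner, ht, div_mul_cancel₀ _ hv₀pos.ne', add_neg_cancel]
  refine ⟨w + t • u, fun h0 ↦ ?_, fun v hv ↦ ?_, ?_⟩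
  · have h1 : inner ℝ w (w + t • u) = inner ℝ w w := by
      rw [inner_add_right, real_inner_smul_right, huw, mul_zero, add_zero]
    rw [h0, inner_zero_right] at h1
    exact hw (inner_self_eq_zero.1 h1.symm)
  · rw [hinner]
    rcases le_or_gt (inner ℝ u (v - x)) 0 with h | h
    · have := mul_nonpos_of_nonneg_of_nonpos ht0 h
      linarith [hle v hv]
    · have := (le_div_iff₀ h).1 (hmin v (Finset.mem_filter.2 ⟨hv, h⟩))
      linarith
  · refine lt_of_le_of_ne ?_ fun heq ↦ ?_
    · conv_lhs => rw [hW]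
      refine Submodule.span_mono (image_mono ?_)
      rintro v ⟨hv, h⟩
      refine ⟨hv, ?_⟩
      rw [hinner, h, huW, mul_zero, add_zero]
      rw [hW]
      exact Submodule.subset_span ⟨v, ⟨hv, h⟩, rfl⟩
    · have : v₀ - x ∈ W := by
        rw [heq]
        exact Submodule.subset_span ⟨v₀, ⟨hv₀s, hv₀0⟩, rfl⟩
      exact hv₀pos.ne' (huW _ this)

/-- If a finite set `s` with full-dimensional span from `x` lies on one side of some hyperplane
through `x`, then it lies on one side of a hyperplane spanned by `x` and points of `s`. -/
theorem exists_supporting_finrank_span {s : Finset E} {x : E}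
    (hspan : Submodule.span ℝ ((fun v ↦ v - x) '' (s : Set E)) = ⊤) {w : E} (hw : w ≠ 0)
    (hle : ∀ v ∈ s, inner ℝ w (v - x) ≤ 0) :
    ∃ w' : E, w' ≠ 0 ∧ (∀ v ∈ s, inner ℝ w' (v - x) ≤ 0) ∧ Module.finrank ℝ E ≤ Module.finrank ℝ
      (Submodule.span ℝ ((fun v ↦ v - x) '' {v | v ∈ s ∧ inner ℝ w' (v - x) = 0})) + 1 := by
  by_cases h : Module.finrank ℝ E ≤ Module.finrank ℝ
      (Submodule.span ℝ ((fun v ↦ v - x) '' {v | v ∈ s ∧ inner ℝ w (v - x) = 0})) + 1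
  · exact ⟨w, hw, hle, h⟩
  · obtain ⟨w', hw', hle', hlt⟩ := exists_rotate_supporting hspan hw hle rfl (not_le.1 h)
    have hdecr := Submodule.finrank_lt_finrank_of_lt hlt
    exact exists_supporting_finrank_span hspan hw' hle'
  termination_by Module.finrank ℝ E - Module.finrank ℝ
    (Submodule.span ℝ ((fun v ↦ v - x) '' {v | v ∈ s ∧ inner ℝ w (v - x) = 0}))
  decreasing_by omega

theorem Convex.exists_inner_le_of_mem_frontier {K : Set E} (hK : Convex ℝ K)
    (hintr : (interior K).Nonempty) {x : E} (hx : x ∈ frontier K) :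
    ∃ w : E, w ≠ 0 ∧ ∀ y ∈ K, inner ℝ w (y - x) ≤ 0 := by
  obtain ⟨f, hf⟩ := geometric_hahn_banach_open_point hK.interior isOpen_interior hx.2
  let w := (InnerProductSpace.toDual ℝ E).symm f
  have hw : ∀ y, inner ℝ w y = f y := fun y ↦ InnerProductSpace.toDual_symm_apply
  refine ⟨w, fun h0 ↦ ?_, fun y hy ↦ ?_⟩
  · obtain ⟨y, hy⟩ := hintr
    have h1 := hf y hy
    rw [← hw, ← hw, h0, inner_zero_left, inner_zero_left] at h1
    exact lt_irrefl _ h1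
  · have hcl : K ⊆ closure (interior K) := by
      rw [hK.closure_interior_eq_closure_of_nonempty_interior hintr]
      exact subset_closure
    have h2 : f y ≤ f x := closure_minimal (t := {z | f z ≤ f x}) (fun z hz ↦ (hf z hz).le)
      (isClosed_le f.continuous continuous_const) (hcl hy)
    rw [inner_sub_right, hw, hw]
    linarith

end Facets

theorem vectorSpan_eq_top_of_nonempty_interior {E : Type*} [NormedAddCommGroup E]
    [NormedSpace ℝ E] {K : Set E} (hintr : (interior K).Nonempty) :
    vectorSpan ℝ K = ⊤ := by
  have h1 : affineSpan ℝ K = ⊤ :=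
    top_unique ((isOpen_interior.affineSpan_eq_top hintr).ge.trans
      (affineSpan_mono ℝ interior_subset))
  rw [← direction_affineSpan, h1, AffineSubspace.direction_top]


/-! ### Facets of simple polytopes -/

section SimplePolytope

variable {n : ℕ} {P F : Set (EuclideanSpace ℝ (Fin n))}

/-- Rotate a supporting hyperplane at `x` until the points of `s` on it span it from `x`. The
exposed face then has dimension at least `n - 1`, and at most `n - 1` because it lies in the
hyperplane. -/
theorem exists_isFacet_of_mem_frontier {s : Finset (EuclideanSpace ℝ (Fin n))}
    (hintr : (interior (convexHull ℝ (s : Set (EuclideanSpace ℝ (Fin n))))).Nonempty)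
    {x : EuclideanSpace ℝ (Fin n)} (hx : x ∈ frontier (convexHull ℝ (s : Set _))) :
    ∃ F, IsFacet (convexHull ℝ (s : Set _)) F ∧ x ∈ F := by
  set P := convexHull ℝ (s : Set (EuclideanSpace ℝ (Fin n))) with hP
  have hconv : Convex ℝ P := convex_convexHull ℝ _
  have hclosed : IsClosed P := s.finite_toSet.isClosed_convexHull ℝ
  have hxP : x ∈ P := hclosed.frontier_subset hx
  have hspan : Submodule.span ℝ ((fun v ↦ v - x) '' (s : Set (EuclideanSpace ℝ (Fin n)))) = ⊤ := by
    rw [eq_top_iff, ← vectorSpan_eq_top_of_nonempty_interior hintr, hP, ← direction_affineSpan,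
      affineSpan_convexHull, direction_affineSpan, vectorSpan_def, Submodule.span_le]
    rintro _ ⟨v₁, hv₁, v₂, hv₂, rfl⟩
    have h1 := Submodule.sub_mem _ (Submodule.subset_span (R := ℝ) (mem_image_of_mem (· - x) hv₁))
      (Submodule.subset_span (mem_image_of_mem (· - x) hv₂))
    simpa using h1
  obtain ⟨w₀, hw₀, hle₀⟩ := hconv.exists_inner_le_of_mem_frontier hintr hx
  obtain ⟨w, hw, hle, hrank⟩ := exists_supporting_finrank_span hspan hw₀
    fun v hv ↦ hle₀ v (subset_convexHull ℝ _ hv)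
  have hleP : ∀ y ∈ P, inner ℝ w y ≤ inner ℝ w x := by
    have : P ⊆ {y | inner ℝ w y ≤ inner ℝ w x} :=
      convexHull_min (fun v hv ↦ by simpa [inner_sub_right] using hle v hv)
        (convex_halfSpace_le (innerSL ℝ w).toLinearMap.isLinear _)
    exact this
  let F := {y | y ∈ P ∧ ∀ z ∈ P, innerSL ℝ w z ≤ innerSL ℝ w y}
  have hxF : x ∈ F := ⟨hxP, by simpa using hleP⟩
  have hF : ∀ y ∈ F, inner ℝ w y = inner ℝ w x := fun y hy ↦
    le_antisymm (hleP y hy.1) (by simpa using hy.2 x hxP)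
  refine ⟨F, ⟨fun _ ↦ ⟨innerSL ℝ w, rfl⟩, ⟨x, hxF⟩, ?_⟩, hxF⟩
  have hlower : Submodule.span ℝ ((fun v ↦ v - x) '' {v | v ∈ s ∧ inner ℝ w (v - x) = 0}) ≤
      vectorSpan ℝ F := by
    rw [Submodule.span_le]
    rintro _ ⟨v, ⟨hv, h0⟩, rfl⟩
    rw [inner_sub_right, sub_eq_zero] at h0
    exact vsub_mem_vectorSpan ℝ
      (show v ∈ F from ⟨subset_convexHull ℝ _ hv, by simpa [h0] using hleP⟩) hxF
  have hupper : vectorSpan ℝ F ≤ (Submodule.span ℝ {w})ᗮ := by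
    rw [vectorSpan_def, Submodule.span_le]
    rintro _ ⟨y, hy, z, hz, rfl⟩
    refine Submodule.mem_orthogonal_singleton_iff_inner_right.2 ?_
    change inner ℝ w (y - z) = 0
    rw [inner_sub_right, hF y hy, hF z hz, sub_self]
  have h1 := Submodule.finrank_mono hlower
  have h2 := Submodule.finrank_mono hupper
  have h3 := (Submodule.span ℝ {w}).finrank_add_finrank_orthogonal
  rw [finrank_span_singleton hw] at h3
  rw [finrank_euclideanSpace_fin] at h3 hrank
  omega

/-- The inequality is strict because a linear functional with a maximum at an interior point is
zero; the facet would then be all of `P`, of dimension `n`. -/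
theorem IsFacet.exists_normal (hF : IsFacet P F) (hintr : (interior P).Nonempty) :
    ∃ (w : EuclideanSpace ℝ (Fin n)) (c : ℝ), (∀ y ∈ F, inner ℝ w y = c) ∧
      ∀ p ∈ interior P, inner ℝ w p < c := by
  obtain ⟨x, hx⟩ := hF.nonempty
  obtain ⟨l, hl⟩ := hF.exposed hF.nonempty
  let w := (InnerProductSpace.toDual ℝ _).symm l
  have hw : ∀ y, inner ℝ w y = l y := fun y ↦ InnerProductSpace.toDual_symm_apply
  have hmax : ∀ y ∈ F, y ∈ P ∧ ∀ z ∈ P, l z ≤ l y := fun y hy ↦ by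
    rw [hl] at hy; exact hy
  refine ⟨w, l x, fun y hy ↦ ?_, fun p hp ↦ ?_⟩
  · rw [hw]
    exact le_antisymm ((hmax x hx).2 y (hmax y hy).1) ((hmax y hy).2 x (hmax x hx).1)
  · rw [hw]
    refine lt_of_le_of_ne ((hmax x hx).2 p (interior_subset hp)) fun heq ↦ ?_
    have hloc : IsLocalMax l p := by
      filter_upwards [mem_interior_iff_mem_nhds.1 hp] with z hz
      rw [heq]
      exact (hmax x hx).2 z hz
    have hl0 : l = 0 := hloc.hasFDerivAt_eq_zero l.hasFDerivAt
    have hFP : F = P := by rw [hl, hl0]; simp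
    have h1 := hF.finrank_add_one
    rw [hFP, vectorSpan_eq_top_of_nonempty_interior hintr, finrank_top,
      finrank_euclideanSpace_fin] at h1
    omega

theorem IsSimplePolytope.isCompact (hP : IsSimplePolytope P) : IsCompact P := by
  obtain ⟨s, rfl⟩ := hP.exists_convexHull
  exact s.finite_toSet.isCompact_convexHull ℝ

theorem IsSimplePolytope.convex (hP : IsSimplePolytope P) : Convex ℝ P := by
  obtain ⟨s, rfl⟩ := hP.exists_convexHull
  exact convex_convexHull ℝ _

theorem IsFacet.isClosed (hF : IsFacet P F) (hP : IsSimplePolytope P) : IsClosed F :=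
  hF.exposed.isClosed hP.isCompact.isClosed

/-- Every facet contains a vertex of `P`; there are finitely many vertices, each in exactly `n`
facets. -/
theorem IsSimplePolytope.finite_setOf_isFacet (hP : IsSimplePolytope P) :
    {F | IsFacet P F}.Finite := by
  have hext : (P.extremePoints ℝ).Finite := by
    obtain ⟨s, rfl⟩ := hP.exists_convexHull
    exact s.finite_toSet.subset extremePoints_convexHull_subset
  refine (hext.biUnion (t := fun v ↦ {F | IsFacet P F ∧ v ∈ F}) fun v hv ↦ ?_).subset
    fun F hF ↦ ?_
  · exact Set.finite_of_encard_eq_coe (hP.encard_facets v hv)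
  · obtain ⟨v, hv⟩ := (hP.isCompact.of_isClosed_subset (hF.isClosed hP)
      hF.exposed.subset).extremePoints_nonempty hF.nonempty
    exact mem_biUnion (hF.exposed.isExtreme.extremePoints_subset_extremePoints hv) ⟨hF, hv.1⟩

end SimplePolytope

/-! ### General position and Lebesgue numbers -/

theorem Polynomial.exists_pos_lt_forall_eval_ne_zero {κ : Type*} [Finite κ]
    (p : κ → Polynomial ℝ) (hp : ∀ k, p k ≠ 0) {ε : ℝ} (hε : 0 < ε) :
    ∃ t, 0 < t ∧ t < ε ∧ ∀ k, (p k).eval t ≠ 0 := by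
  have hfin : (⋃ k, {t | (p k).IsRoot t}).Finite :=
    finite_iUnion fun k ↦ Polynomial.finite_setOfPred_isRoot (hp k)
  obtain ⟨t, ht, htr⟩ := ((Ioo_infinite hε).sdiff hfin).nonempty
  exact ⟨t, ht.1, ht.2, fun k h0 ↦ htr (mem_iUnion.2 ⟨k, h0⟩)⟩

/-- A finite family of vectors in `ℝⁿ` can be perturbed so that any system of at most `n` linear
equations with these coefficient vectors is solvable. -/
theorem exists_perturbation_solvable {n : ℕ} {κ : Type*} [Finite κ]
    (w : κ → EuclideanSpace ℝ (Fin n)) {η : ℝ} (hη : 0 < η) :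
    ∃ w' : κ → EuclideanSpace ℝ (Fin n), (∀ k, ‖w' k - w k‖ < η) ∧
      ∀ (J : Set κ), J.encard ≤ n → ∀ c : κ → ℝ, ∃ a, ∀ k ∈ J, inner ℝ (w' k) a = c k := by
  classical
  obtain ⟨m, ⟨e⟩⟩ := Finite.exists_equiv_fin κ
  -- The `n` dummy indices allow any system of at most `n` equations to be padded to exactly `n`.
  let i : κ → Fin (m + n) := fun k ↦ Fin.castAdd n (e k)
  have hi : Function.Injective i := (Fin.castAdd_injective m n).comp e.injective
  let node : Fin (m + n) → ℝ := fun j ↦ (j : ℕ)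
  have hnode : Function.Injective node := fun a b h ↦ Fin.ext (Nat.cast_injective h)
  let V : Fin (m + n) → Fin n → ℝ := fun j l ↦ node j ^ (l : ℕ)
  let W : Fin (m + n) → Fin n → ℝ := Function.extend i (fun k l ↦ w k l) 0
  -- The coefficient of degree `n` is a Vandermonde determinant with distinct nodes, so each `q σ`
  -- is nonzero and a small `t` avoids all their roots.
  let q : (Fin n ↪ Fin (m + n)) → Polynomial ℝ := fun σ ↦
    Matrix.det ((Polynomial.X : Polynomial ℝ) • (Matrix.of fun r ↦ V (σ r)).map Polynomial.C +
      (Matrix.of fun r ↦ W (σ r)).map Polynomial.C)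
  have hq : ∀ σ, q σ ≠ 0 := by
    intro σ h0
    have h1 := Polynomial.coeff_det_X_add_C_card (Matrix.of fun r ↦ V (σ r))
      (Matrix.of fun r ↦ W (σ r))
    have h2 : Matrix.of (fun r ↦ V (σ r)) = Matrix.vandermonde (node ∘ σ) := by
      ext r l; simp [V, Matrix.vandermonde_apply]
    change (q σ).coeff _ = _ at h1
    rw [h0, Polynomial.coeff_zero, h2] at h1
    exact Matrix.det_vandermonde_ne_zero_iff.2 (hnode.comp σ.injective) h1.symm
  cases nonempty_fintype κ
  let S : ℝ := ∑ k, ‖WithLp.toLp 2 (V (i k))‖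
  have hS : 0 ≤ S := Finset.sum_nonneg fun _ _ ↦ norm_nonneg _
  obtain ⟨t, ht0, ht, htq⟩ := Polynomial.exists_pos_lt_forall_eval_ne_zero q hq
    (show 0 < η / (S + 1) by positivity)
  refine ⟨fun k ↦ w k + t • WithLp.toLp 2 (V (i k)), fun k ↦ ?_, fun J hJ c ↦ ?_⟩
  · rw [add_sub_cancel_left, norm_smul, Real.norm_of_nonneg ht0.le]
    have h1 : ‖WithLp.toLp 2 (V (i k))‖ ≤ S :=
      Finset.single_le_sum (f := fun k ↦ ‖WithLp.toLp 2 (V (i k))‖)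
        (fun _ _ ↦ norm_nonneg _) (Finset.mem_univ k)
    have h2 := (lt_div_iff₀ (by positivity)).1 ht
    nlinarith
  · have hcard : (Finset.univ.filter fun j ↦ j ∈ i '' J).card ≤ n := by
      rw [← Nat.cast_le (α := ℕ∞), ← Set.encard_coe_eq_coe_finsetCard]
      rwa [Finset.coe_filter_univ, Set.ofPred_mem_eq, hi.encard_image]
    obtain ⟨T, hT, -, hTn⟩ := Finset.exists_subsuperset_card_eq
      (Finset.filter_subset (fun j ↦ j ∈ i '' J) Finset.univ) hcard (by simp)
    let σ : Fin n ↪ Fin (m + n) := (T.orderEmbOfFin hTn).toEmbedding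
    have hdet := htq σ
    simp only [q] at hdet
    rw [Matrix.eval_det_X_smul_map_C_add] at hdet
    set M := t • (Matrix.of fun r ↦ V (σ r)) + (Matrix.of fun r ↦ W (σ r)) with hM
    let b : Fin (m + n) → ℝ := Function.extend i c 0
    refine ⟨WithLp.toLp 2 (M⁻¹.mulVec fun r ↦ b (σ r)), fun k hk ↦ ?_⟩
    have hmem : i k ∈ Set.range σ := by
      change i k ∈ Set.range (T.orderEmbOfFin hTn)
      rw [Finset.range_orderEmbOfFin]
      exact hT (by simpa using ⟨k, hk, rfl⟩)
    obtain ⟨r, hr⟩ := hmem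
    have h1 : M.mulVec (M⁻¹.mulVec fun r ↦ b (σ r)) r = b (σ r) := by
      rw [Matrix.mulVec_mulVec, Matrix.mul_nonsing_inv _ (isUnit_iff_ne_zero.2 hdet),
        Matrix.one_mulVec]
    rw [hr, show b (i k) = c k from hi.extend_apply _ _ _] at h1
    rw [← h1]
    have h2 : W (i k) = fun l ↦ w k l := hi.extend_apply _ _ _
    simp only [PiLp.inner_apply, Matrix.mulVec, dotProduct, hM]
    refine Finset.sum_congr rfl fun l _ ↦ ?_
    simp [hr, h2]
    ring

/-- For a finite family of closed sets there is a radius `ε` such that the members meeting any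
`ε`-ball centred in a compact set `K` have a common point in `K`. -/
theorem IsCompact.exists_forall_ball_inter_nonempty_imp_mem {α κ : Type*} [PseudoMetricSpace α]
    [Finite κ] {K : Set α} (hK : IsCompact K) {A : κ → Set α} (hA : ∀ k, IsClosed (A k)) :
    ∃ ε > 0, ∀ y ∈ K, ∃ x ∈ K, ∀ k, (A k ∩ ball y ε).Nonempty → x ∈ A k := by
  -- A ball inside `U x` meets only members that contain `x`.
  let U : K → Set α := fun x ↦ (⋃ k ∈ {k | (x : α) ∉ A k}, A k)ᶜ
  obtain ⟨ε, hε, h⟩ := lebesgue_number_lemma_of_metric (c := U) hK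
    (fun x ↦ ((Set.toFinite _).isClosed_biUnion fun k _ ↦ hA k).isOpen_compl)
    fun x hx ↦ mem_iUnion.2 ⟨⟨x, hx⟩, by simp [U]⟩
  refine ⟨ε, hε, fun y hy ↦ ?_⟩
  obtain ⟨x, hx⟩ := h y hy
  refine ⟨x, x.2, fun k ⟨z, hzA, hzy⟩ ↦ ?_⟩
  by_contra hxk
  exact hx hzy (mem_biUnion (x := k) hxk hzA)

/-- At most `n` points span an affine subspace of dimension below `n`, which is null; finitely many
null sets cannot cover a nonempty open set. -/
theorem exists_mem_forall_notMem_convexHull {n : ℕ} {ι : Type*} [Finite ι]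
    (a : ι → EuclideanSpace ℝ (Fin n)) {O : Set (EuclideanSpace ℝ (Fin n))} (hO : IsOpen O)
    (hne : O.Nonempty) :
    ∃ p ∈ O, ∀ J : Set ι, J.encard ≤ n → p ∉ convexHull ℝ (a '' J) := by
  by_contra! h
  have hsub : O ⊆ ⋃ J ∈ {J : Set ι | J.encard ≤ n}, convexHull ℝ (a '' J) := fun p hp ↦ by
    obtain ⟨J, hJ, hpJ⟩ := h p hp
    exact mem_biUnion (x := J) hJ hpJ
  refine (hO.measure_pos volume hne).ne' (measure_mono_null hsub ?_)
  refine (measure_biUnion_null_iff (Set.toFinite _).countable).2 fun J hJ ↦ ?_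
  refine measure_mono_null (convexHull_subset_affineSpan _)
    (Measure.addHaar_affineSubspace volume _ fun htop ↦ ?_)
  have hfin : (a '' J).Finite := Set.toFinite _
  have hne' : (a '' J).Nonempty := by
    rw [nonempty_iff_ne_empty]
    intro h0
    rw [h0, AffineSubspace.span_empty] at htop
    exact bot_ne_top htop
  have h1 : Module.finrank ℝ (vectorSpan ℝ (a '' J)) = n := by
    rw [← direction_affineSpan, htop, AffineSubspace.direction_top, finrank_top,
      finrank_euclideanSpace_fin]
  obtain ⟨J', hJ'⟩ := (Set.toFinite J).exists_finset_coe
  have hJc : J'.card ≤ n := by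
    rw [← hJ', mem_ofPred_eq, Set.encard_coe_eq_coe_finsetCard] at hJ
    exact_mod_cast hJ
  classical
  have hpos : 0 < J'.card := by
    rw [Finset.card_pos, ← Finset.coe_nonempty, hJ']
    exact hne'.of_image
  have h2 := finrank_vectorSpan_image_finset_le ℝ a J' (n := J'.card - 1) (by omega)
  rw [Finset.coe_image, hJ', h1] at h2
  omega

/-! ### The covering argument -/

theorem mainTheorem5 {n : ℕ} (P : Set (EuclideanSpace ℝ (Fin n))) (hP : IsSimplePolytope P)
    {ι : Type*} [Finite ι] (X : ι → Set (EuclideanSpace ℝ (Fin n)))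
    (hclosed : ∀ i, IsClosed (X i))
    (hcover : P ⊆ ⋃ i, X i)
    (hmult : ∀ x ∈ P, {i | x ∈ X i}.encard ≤ n) :
    ∃ i, (n : ℕ∞) + 1 ≤ {F | IsFacet P F ∧ (X i ∩ F).Nonempty}.encard := by
  by_contra! hfew
  have hfew' : ∀ i, {F | IsFacet P F ∧ (X i ∩ F).Nonempty}.encard ≤ n := fun i ↦
    ENat.lt_add_one_iff (ENat.natCast_ne_top n) |>.1 (hfew i)
  let κ := {F // IsFacet P F}
  have : Finite κ := hP.finite_setOf_isFacet
  choose w c hwF hwint using fun F : κ ↦ F.2.exists_normal hP.interior_nonempty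
  obtain ⟨p₀, hp₀⟩ := hP.interior_nonempty
  obtain ⟨η, hη, hηc⟩ : ∃ η > 0, ∀ F : κ, η < c F - inner ℝ (w F) p₀ := by
    rcases isEmpty_or_nonempty κ with h | h
    · exact ⟨1, one_pos, fun F ↦ h.elim F⟩
    · obtain ⟨F₀, hF₀⟩ := Finite.exists_min fun F : κ ↦ c F - inner ℝ (w F) p₀
      have h0 : 0 < c F₀ - inner ℝ (w F₀) p₀ := sub_pos.2 (hwint F₀ p₀ hp₀)
      exact ⟨_, half_pos h0, fun F ↦ (half_lt_self h0).trans_le (hF₀ F)⟩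
  obtain ⟨D, hD0, hD⟩ : ∃ D > 0, ∀ x ∈ P, ‖x‖ ≤ D := hP.isCompact.isBounded.exists_pos_norm_le
  -- The inner products are needed at `p` and at `x - p` with `x, p ∈ P`, of norm at most `2 * D`;
  -- there they change by at most `η`.
  obtain ⟨w', hw', hsolve⟩ := exists_perturbation_solvable w (η := η / (2 * D)) (by positivity)
  have hclose : ∀ (F : κ) (y : EuclideanSpace ℝ (Fin n)), ‖y‖ ≤ 2 * D →
      |inner ℝ (w' F) y - inner ℝ (w F) y| ≤ η := by
    intro F y hy
    rw [← inner_sub_left]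
    calc |inner ℝ (w' F - w F) y| ≤ ‖w' F - w F‖ * ‖y‖ := abs_real_inner_le_norm _ _
      _ ≤ η / (2 * D) * (2 * D) := by gcongr; exact (hw' F).le
      _ = η := div_mul_cancel₀ _ (by positivity)
  have hJ : ∀ i, {F : κ | (X i ∩ F).Nonempty}.encard ≤ n := fun i ↦ by
    rw [← Subtype.val_injective.encard_image]
    refine (encard_le_encard ?_).trans (hfew' i)
    rintro _ ⟨F, hF, rfl⟩
    exact ⟨F.2, hF⟩
  choose a ha using fun i ↦ hsolve _ (hJ i) c
  obtain ⟨p, ⟨hpint, hpη⟩, hpa⟩ := exists_mem_forall_notMem_convexHull a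
    (O := interior P ∩ ⋂ F : κ, {p | η < c F - inner ℝ (w F) p})
    (isOpen_interior.inter (isOpen_iInter_of_finite fun F ↦
      isOpen_lt continuous_const (by fun_prop)))
    ⟨p₀, hp₀, mem_iInter.2 hηc⟩
  rw [mem_iInter] at hpη
  -- Facets join the family so that an `X i` within `ε` of a point of `F` really touches `F`.
  obtain ⟨ε, hε, hball⟩ := hP.isCompact.exists_forall_ball_inter_nonempty_imp_mem
    (A := Sum.elim X fun F : κ ↦ (F : Set _))
    (by rintro (i | F); exacts [hclosed i, F.2.isClosed hP])
  cases nonempty_fintype ι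
  let φ : ι → EuclideanSpace ℝ (Fin n) → ℝ := fun i y ↦ thickenedIndicator hε (X i) y
  have hφ0 : ∀ i y, 0 ≤ φ i y := fun i y ↦ NNReal.coe_nonneg _
  have hφc : ∀ i, Continuous (φ i) := fun i ↦
    NNReal.continuous_coe.comp (thickenedIndicator hε (X i)).continuous
  have hφX : ∀ i y, φ i y ≠ 0 → (X i ∩ ball y ε).Nonempty := by
    intro i y hy
    have hmem : y ∈ thickening ε (X i) := by
      by_contra hy'
      exact hy (NNReal.coe_eq_zero.2 (thickenedIndicator_zero hε _ hy'))
    obtain ⟨z, hz, hyz⟩ := mem_thickening_iff.1 hmem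
    exact ⟨z, hz, by rwa [mem_ball, dist_comm]⟩
  have hsum : ∀ y ∈ P, 0 < ∑ i, φ i y := by
    intro y hy
    obtain ⟨i, hi⟩ := mem_iUnion.1 (hcover hy)
    refine Finset.sum_pos' (fun i _ ↦ hφ0 i y) ⟨i, Finset.mem_univ i, ?_⟩
    exact NNReal.coe_pos.2 ((thickenedIndicator_one hε _ hi).symm ▸ one_pos)
  let g : EuclideanSpace ℝ (Fin n) → EuclideanSpace ℝ (Fin n) := fun y ↦
    Finset.univ.centerMass (fun i ↦ φ i y) a
  have hg : ContinuousOn g P := by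
    refine ContinuousOn.smul (ContinuousOn.inv₀ ?_ fun y hy ↦ (hsum y hy).ne') ?_
    · exact (continuous_finsetSum _ fun i _ ↦ hφc i).continuousOn
    · exact (continuous_finsetSum _ fun i _ ↦ (hφc i).smul continuous_const).continuousOn
  have hgfacet : ∀ F : κ, ∀ y ∈ P, y ∈ (F : Set _) → inner ℝ (w' F) (g y) = c F := by
    intro F y hy hyF
    obtain ⟨x, -, hx⟩ := hball y hy
    have hterm : ∀ i, φ i y * inner ℝ (w' F) (a i) = φ i y * c F := by
      intro i
      by_cases h0 : φ i y = 0
      · simp [h0]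
      · rw [ha i F ⟨x, hx (Sum.inl i) (hφX i y h0),
          hx (Sum.inr F) ⟨y, hyF, mem_ball_self hε⟩⟩]
    simp only [g, Finset.centerMass, real_inner_smul_right, inner_sum, hterm]
    rw [← Finset.sum_mul, inv_mul_cancel_left₀ (hsum y hy).ne']
  obtain ⟨y, hy, hgy⟩ : ∃ y ∈ P, g y = p := by
    -- For `x ∈ F`, both `⟪w' F, g x - p⟫` and `⟪w' F, x - p⟫` are at least `c F - ⟪w F, p⟫ - η >
    -- 0`, so the two vectors are not opposite.
    refine exists_eq_of_forall_frontier hP.convex hP.isCompact hpint hg fun x hx r hr heq ↦ ?_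
    have hxP : x ∈ P := hP.isCompact.isClosed.frontier_subset hx
    obtain ⟨F, hF, hxF⟩ : ∃ F, IsFacet P F ∧ x ∈ F := by
      obtain ⟨s, rfl⟩ := hP.exists_convexHull
      exact exists_isFacet_of_mem_frontier hP.interior_nonempty hx
    have hpP : p ∈ P := interior_subset hpint
    have h1 := hclose ⟨F, hF⟩ p (by linarith [hD p hpP])
    have h2 := hclose ⟨F, hF⟩ (x - p) ((norm_sub_le x p).trans (by linarith [hD p hpP, hD x hxP]))
    have h3 := hpη ⟨F, hF⟩
    rw [mem_ofPred_eq] at h3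
    have h4 := congrArg (inner ℝ (w' ⟨F, hF⟩)) heq
    rw [inner_sub_right, hgfacet ⟨F, hF⟩ x hxP hxF, inner_neg_right, real_inner_smul_right] at h4
    rw [inner_sub_right (w ⟨F, hF⟩), hwF ⟨F, hF⟩ x hxF] at h2
    rw [abs_le] at h1 h2
    have h5 : 0 ≤ r * inner ℝ (w' ⟨F, hF⟩) (x - p) := mul_nonneg hr (by linarith)
    linarith
  obtain ⟨x, hxP, hx⟩ := hball y hy
  -- All `X i` with nonzero weight at `y` share the point `x ∈ P`, so there are at most `n` of them.
  refine hpa {i | φ i y ≠ 0} ((encard_le_encard fun i hi ↦ ?_).trans (hmult x hxP)) ?_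
  · exact hx (Sum.inl i) (hφX i y hi)
  · rw [← hgy]
    have hmem := Finset.centerMass_mem_convexHull (R := ℝ) (s := a '' {i | φ i y ≠ 0})
      (Finset.univ.filter fun i ↦ φ i y ≠ 0) (w := fun i ↦ φ i y) (z := a)
      (fun i _ ↦ hφ0 i y) (by rw [Finset.sum_filter_ne_zero]; exact hsum y hy)
      (fun i hi ↦ mem_image_of_mem a (Finset.mem_filter.1 hi).2)
    rwa [Finset.centerMass_filter_ne_zero] at hmem
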